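/- There is a constant $c>0$ such that the following holds for every even integer $n\ge 2$. Let $G=(V,E)$ be the $n\times n$ grid: $V=\{(i,j)\in\mathbb Z^2:1\le i,j\le n\}$ with nearest-neighbour edges. Let $J=(J_e)_{e\in E}$ be i.i.d. standard Gaussian couplings, and let $\sigma=\sigma(J)\in\{-1,+1\}^V$ be a ground state, i.e. a maximizer of $$H(\sigma)=\sum_{e=\{x,y\}\in E}J_e\,\sigma_x\sigma_y ,$$ which is almost surely unique up to a global sign flip. For $w,z\in V$ the relative spin $\sigma_w\sigma_z$ is thus an almost surely well-defined function of $J$. Let $h_k$ ($k\ge 0$) be the Hermite polynomials, normalized to be orthonormal in $L^2$ of the standard Gaussian law, and for $\mathbf k=(k_e)_{e\in E}\in\{0,1,2,\dots\}^E$ put $h_{\mathbf k}(J)=\prod_{e\in E}h_{k_e}(J_e)$. Let $u=(1,n/2)$ and $v=(n,n/2)$, let $\alpha_{\mathbf k}=\mathbb E[\sigma_u\sigma_v\,h_{\mathbf k}(J)]$, and define the spectral measure of $\sigma_u\sigma_v$ by $\mu(\mathbf k)=\alpha_{\mathbf k}^2$ and, for $S\subseteq E$, $$\mu(S)=\sum_{\mathbf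 k:\ \{e\in E:\,k_e\ge 1\}=S}\mu(\mathbf k).$$ Let $\mathcal L=\{\{(k,n/2),(k+1,n/2)\}:1\le k<n\}\subseteq E$ be the horizontal line of edges joining $u$ and $v$. Then $$\mu(\mathcal L)\le \exp(-cn).$$ -/

import Mathlib

namespace EdwardsAnderson

section Model

variable {V : Type*} (G : SimpleGraph V)

/-- Coupling constants: one real number `J e` for each edge `e` of `G`. -/
abbrev Couplings : Type _ := G.edgeSet → ℝ

/-- Spin configurations `σ ∈ {-1, +1}^V` (`ℤˣ` is the two-element group `{1, -1}`). -/
abbrev Spins (V : Type*) : Type _ := V → ℤˣ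

/-- The product `σ_x σ_y` of the spins at the two ends of an edge `e = {x, y}`. -/
def bond (σ : Spins V) (e : Sym2 V) : ℤˣ :=
  Sym2.lift ⟨fun x y => σ x * σ y, fun x y => mul_comm (σ x) (σ y)⟩ e

/-- The Hamiltonian `H(σ) = ∑_{e = {x, y}} J_e σ_x σ_y`. -/
noncomputable def hamiltonian [Fintype G.edgeSet] (J : Couplings G) (σ : Spins V) : ℝ :=
  ∑ e : G.edgeSet, J e * ((bond σ (e : Sym2 V) : ℤ) : ℝ)

/-- A ground state is a spin configuration that maximizes the Hamiltonian. -/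
def IsGroundState [Fintype G.edgeSet] (J : Couplings G) (σ : Spins V) : Prop :=
  ∀ τ : Spins V, hamiltonian G J τ ≤ hamiltonian G J σ

theorem exists_isGroundState [Finite V] [Fintype G.edgeSet] (J : Couplings G) :
    ∃ σ : Spins V, IsGroundState G J σ :=
  Finite.exists_max (hamiltonian G J)

/-- A ground state for the couplings `J`.  On a connected graph the choice is immaterial:
for almost every `J` the ground state is unique up to a global sign flip. -/
noncomputable def groundState [Finite V] [Fintype G.edgeSet] (J : Couplings G) : Spins V :=
  Classical.choose (exists_isGroundState G J)

/-- The relative spin `σ_u σ_v` of the ground state, as a function of the couplings. -/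
noncomputable def relativeSpin [Finite V] [Fintype G.edgeSet] (u v : V) (J : Couplings G) : ℝ :=
  ((groundState G J u * groundState G J v : ℤˣ) : ℤ)

/-- The law of i.i.d. standard Gaussian couplings. -/
noncomputable def couplingLaw [Fintype G.edgeSet] : MeasureTheory.Measure (Couplings G) :=
  MeasureTheory.Measure.pi fun _ => ProbabilityTheory.gaussianReal 0 1

/-- The Hermite polynomial of degree `k`, normalized to have unit norm in `L²` of the standard
Gaussian (`Polynomial.hermite k` is the monic one, of squared norm `k!`). -/
noncomputable def hermiteNormalized (k : ℕ) (x : ℝ) : ℝ :=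
  Polynomial.aeval x (Polynomial.hermite k) / Real.sqrt (k.factorial : ℝ)

/-- The tensor product `h_k(J) = ∏_e h_{k_e}(J_e)` for a multi-index `k ∈ ℕ^E`. -/
noncomputable def hermiteTensor [Fintype G.edgeSet] (k : G.edgeSet → ℕ) (J : Couplings G) : ℝ :=
  ∏ e : G.edgeSet, hermiteNormalized (k e) (J e)

/-- The Fourier-Hermite coefficient `α_k = 𝔼[σ_u σ_v h_k(J)]`. -/
noncomputable def fourierCoeff [Finite V] [Fintype G.edgeSet] (u v : V) (k : G.edgeSet → ℕ) : ℝ :=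
  ∫ J, relativeSpin G u v J * hermiteTensor G k J ∂(couplingLaw G)

/-- The support `E_k = {e : k_e ≥ 1}` of a multi-index. -/
def indexSupport (k : G.edgeSet → ℕ) : Set G.edgeSet :=
  {e | 1 ≤ k e}

/-- The spectral measure of `σ_u σ_v` on `ℕ^E`, with mass `α_k ^ 2` at each multi-index `k`. -/
noncomputable def spectralMeasure [Finite V] [Fintype G.edgeSet] (u v : V) :
    MeasureTheory.Measure (G.edgeSet → ℕ) :=
  MeasureTheory.Measure.sum fun k =>
    ENNReal.ofReal (fourierCoeff G u v k ^ 2) • MeasureTheory.Measure.dirac k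

/-- `μ(S) = ∑_{k : E_k = S} μ(k)`: the spectral mass of the multi-indices whose support is
exactly the set of edges `S`. -/
noncomputable def spectralMass [Finite V] [Fintype G.edgeSet] (u v : V) (S : Set G.edgeSet) :
    ENNReal :=
  spectralMeasure G u v {k | indexSupport G k = S}

end Model

section Grid

/-- The `n × n` grid with nearest-neighbour edges. -/
def grid (n : ℕ) : SimpleGraph (Fin n × Fin n) :=
  (SimpleGraph.pathGraph n).boxProd (SimpleGraph.pathGraph n)

noncomputable instance gridEdgeFintype (n : ℕ) : Fintype (grid n).edgeSet :=
  Fintype.ofFinite _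

/-- The grid vertex whose coordinates are `(i, j)` when counted from `1` to `n`. -/
def vertex (n i j : ℕ) (hi : 1 ≤ i ∧ i ≤ n) (hj : 1 ≤ j ∧ j ≤ n) : Fin n × Fin n :=
  (⟨i - 1, by omega⟩, ⟨j - 1, by omega⟩)

/-- The horizontal line of edges `{(k, j), (k + 1, j)}`, `1 ≤ k < n`, at height `j`. -/
def horizontalLine (n j : ℕ) (hj : 1 ≤ j ∧ j ≤ n) : Set (grid n).edgeSet :=
  {e | ∃ (k : ℕ) (hk : 1 ≤ k ∧ k < n),
    (e : Sym2 (Fin n × Fin n)) =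
      s(vertex n k j ⟨hk.1, hk.2.le⟩ hj, vertex n (k + 1) j ⟨by omega, hk.2⟩ hj)}

theorem half_mem {n : ℕ} (hpos : 0 < n) (heven : Even n) : 1 ≤ n / 2 ∧ n / 2 ≤ n := by
  obtain ⟨m, hm⟩ := heven
  omega

end Grid

end EdwardsAnderson

namespace EdwardsAnderson

/-! ### Hermite polynomials: orthonormality and Bessel's inequality under the Gaussian law -/

section Hermite

open MeasureTheory ProbabilityTheory Polynomial

/-! Consider a plaquette resting on an edge `e` of the line. Suppose its vertical sides outweigh the
other couplings at their lower ends, and its top side outweighs the others at its left end. The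
ground state must satisfy these three edges, so their bonds are given by the signs of their
couplings. The bond across `e` is their product, hence insensitive to the sign of `J e`.

On this event, negate all couplings that cross the vertical cut through `e`, except `J e` itself.
With `J e` included this would be a gauge transformation, which negates `σ_u σ_v`; the sign of `J e`
does not matter here, so `σ_u σ_v` is still negated (`relativeSpin_signFlip`). The line meets the
cut only in `e`, so its couplings are untouched, and so is every Hermite tensor supported on the
line. The Gaussian law and the event, which depends only on absolute values, are preserved as well.
Therefore the event contributes nothing to `α_k` (`fourierCoeff_eq_integral_indicator`).

Doing this at every third edge, `α_k` becomes the coefficient of `σ_u σ_v` restricted to the event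
`N` that no plaquette is good, and Bessel's inequality bounds the spectral mass by the probability
of `N` (`spectralMass_le_measure_iInter_compl`). Plaquettes in every third column constrain disjoint
sets of edges, so the events are independent (`iIndepSet_plaquetteEvent`), each with probability
bounded below uniformly in `n`. Hence `N` is exponentially unlikely. -/

theorem integrable_eval_gaussianReal (q : ℝ[X]) :
    Integrable (fun x => q.eval x) (gaussianReal 0 1) := by
  induction q using Polynomial.induction_on' with
  | add p q hp hq =>
    simp only [eval_add]
    exact hp.add hq
  | monomial n a =>
    simp only [eval_monomial]
    refine Integrable.const_mul ?_ a
    have h := (memLp_id_gaussianReal (μ := 0) (v := 1) n).integrable_norm_pow'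
    refine h.mono' (by fun_prop) (Filter.Eventually.of_forall fun x => ?_)
    simp

theorem integrable_eval_mul_gaussianPDFReal (q : ℝ[X]) :
    Integrable (fun x => q.eval x * gaussianPDFReal 0 1 x) := by
  have h := integrable_eval_gaussianReal q
  rw [gaussianReal_of_var_ne_zero _ one_ne_zero,
    integrable_withDensity_iff (measurable_gaussianPDF _ _)
      (Filter.Eventually.of_forall fun _ => gaussianPDF_lt_top)] at h
  simpa [toReal_gaussianPDF] using h

theorem hasDerivAt_gaussianPDFReal_standard (x : ℝ) :
    HasDerivAt (gaussianPDFReal 0 1) (-x * gaussianPDFReal 0 1 x) x := by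
  have h : HasDerivAt (fun y : ℝ => (√(2 * Real.pi * (1 : NNReal)))⁻¹ *
      Real.exp (-(y - 0) ^ 2 / (2 * (1 : NNReal))))
      ((√(2 * Real.pi * (1 : NNReal)))⁻¹ * (Real.exp (-(x - 0) ^ 2 / (2 * (1 : NNReal))) *
        (-x))) x := by
    refine HasDerivAt.const_mul _ (HasDerivAt.exp ?_)
    have h2 : HasDerivAt (fun y : ℝ => -(y - 0) ^ 2 / (2 * ((1 : NNReal) : ℝ)))
        (-(((2 : ℕ) : ℝ) * (x - 0) ^ (2 - 1) * 1) / (2 * ((1 : NNReal) : ℝ))) x :=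
      (((hasDerivAt_id x).sub_const 0).pow 2).neg.div_const _
    convert h2 using 1
    simp [neg_div]
  rw [gaussianPDFReal_def]
  convert h using 1
  ring

/-- Gaussian integration by parts for polynomials. -/
theorem integral_mul_eval_gaussianReal (q : ℝ[X]) :
    ∫ x, x * q.eval x ∂(gaussianReal 0 1) = ∫ x, q.derivative.eval x ∂(gaussianReal 0 1) := by
  rw [integral_gaussianReal_eq_integral_smul one_ne_zero,
    integral_gaussianReal_eq_integral_smul one_ne_zero]
  have h := integral_mul_deriv_eq_deriv_mul_of_integrable (A := ℝ)
    (u := fun x => q.eval x) (u' := fun x => q.derivative.eval x)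
    (v := gaussianPDFReal 0 1) (v' := fun x => -x * gaussianPDFReal 0 1 x)
    (fun x _ => q.hasDerivAt x) (fun x _ => hasDerivAt_gaussianPDFReal_standard x)
    (by
      refine (integrable_eval_mul_gaussianPDFReal (-X * q)).congr
        (Filter.Eventually.of_forall fun x => ?_)
      simp; ring)
    (integrable_eval_mul_gaussianPDFReal _) (integrable_eval_mul_gaussianPDFReal q)
  rw [← neg_inj, ← integral_neg]
  calc ∫ x, -(gaussianPDFReal 0 1 x • (x * q.eval x))
      = ∫ x, q.eval x * (-x * gaussianPDFReal 0 1 x) := by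
        congr 1; ext x; simp; ring
    _ = _ := by
        rw [h]; congr 2; ext x; simp [mul_comm]

/-- The recursion `H_{n+1} = x H_n - H_n'` and one Gaussian integration by parts move one derivative
onto `q`. Orthogonality follows because enough derivatives kill a polynomial of lower degree. -/
theorem integral_hermite_mul_eval (n : ℕ) (q : ℝ[X]) :
    ∫ x, aeval x (hermite n) * q.eval x ∂(gaussianReal 0 1) =
      ∫ x, (derivative^[n] q).eval x ∂(gaussianReal 0 1) := by
  induction n generalizing q with
  | zero => simp
  | succ n ih =>
    set p : ℝ[X] := (hermite n).map (Int.castRingHom ℝ) with hp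
    have hpe : ∀ x : ℝ, aeval x (hermite n) = p.eval x := fun x => by
      rw [hp, eval_map, aeval_def]; rfl
    have hpd : ∀ x : ℝ, aeval x (derivative (hermite n)) = p.derivative.eval x := fun x => by
      rw [hp, derivative_map, eval_map, aeval_def]; rfl
    have h1 := integral_mul_eval_gaussianReal (p * q)
    have h2 := ih (derivative q)
    rw [Function.iterate_succ_apply, ← h2]
    have i1 : Integrable (fun x : ℝ => x * (p * q).eval x) (gaussianReal 0 1) :=
      (integrable_eval_gaussianReal (X * (p * q))).congr
        (Filter.Eventually.of_forall fun x => by simp)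
    have i2 := integrable_eval_gaussianReal (derivative p * q)
    have i3 := integrable_eval_gaussianReal (p * derivative q)
    calc ∫ x, aeval x (hermite (n + 1)) * q.eval x ∂(gaussianReal 0 1)
        = ∫ x, (x * (p * q).eval x - (derivative p * q).eval x) ∂(gaussianReal 0 1) := by
          congr 1; ext x
          rw [hermite_succ]
          simp only [map_sub, map_mul, aeval_X, hpe, hpd, eval_mul]
          ring
      _ = _ := by
          rw [integral_sub i1 i2, h1, derivative_mul]
          simp only [eval_add]
          rw [integral_add i2 i3]
          simp [hpe]

theorem integral_hermite_mul_hermite_of_lt {m n : ℕ} (h : m < n) :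
    ∫ x, aeval x (hermite n) * aeval x (hermite m) ∂(gaussianReal 0 1) = 0 := by
  have hpe : ∀ x : ℝ, aeval x (hermite m) = ((hermite m).map (Int.castRingHom ℝ)).eval x :=
    fun x => by rw [eval_map, aeval_def]; rfl
  simp only [hpe]
  rw [integral_hermite_mul_eval, iterate_derivative_eq_zero]
  · simp
  · exact lt_of_le_of_lt natDegree_map_le (by rwa [natDegree_hermite])

theorem integral_hermite_mul_self (n : ℕ) :
    ∫ x, aeval x (hermite n) * aeval x (hermite n) ∂(gaussianReal 0 1) = n.factorial := by
  have hpe : ∀ x : ℝ, aeval x (hermite n) = ((hermite n).map (Int.castRingHom ℝ)).eval x :=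
    fun x => by rw [eval_map, aeval_def]; rfl
  have hd : derivative^[n] ((hermite n).map (Int.castRingHom ℝ)) = C (n.factorial : ℝ) := by
    rw [iterate_derivative_map]
    have h0 : (derivative^[n] (hermite n)).natDegree = 0 := by
      have := natDegree_iterate_derivative (hermite n) n
      rw [natDegree_hermite] at this
      omega
    rw [eq_C_of_natDegree_eq_zero h0, coeff_iterate_derivative]
    simp [Nat.descFactorial_self]
  simp only [hpe]
  have := integral_hermite_mul_eval n ((hermite n).map (Int.castRingHom ℝ))
  simp only [hpe] at this
  rw [this, hd]
  simp

theorem integral_hermiteNormalized_mul (m n : ℕ) :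
    ∫ x, hermiteNormalized m x * hermiteNormalized n x ∂(gaussianReal 0 1) =
      if m = n then 1 else 0 := by
  have h : ∀ x, hermiteNormalized m x * hermiteNormalized n x =
      (Real.sqrt m.factorial * Real.sqrt n.factorial)⁻¹ *
        (aeval x (hermite m) * aeval x (hermite n)) := fun x => by
    unfold hermiteNormalized; field_simp
  simp only [h]
  rw [integral_const_mul]
  split_ifs with hmn
  · subst hmn
    rw [integral_hermite_mul_self, Real.mul_self_sqrt (by positivity)]
    exact inv_mul_cancel₀ (by positivity)
  · rcases lt_or_gt_of_ne hmn with hlt | hlt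
    · simp only [mul_comm (aeval _ (hermite m))]
      rw [integral_hermite_mul_hermite_of_lt hlt, mul_zero]
    · rw [integral_hermite_mul_hermite_of_lt hlt, mul_zero]

theorem integrable_hermiteNormalized_mul (m n : ℕ) :
    Integrable (fun x => hermiteNormalized m x * hermiteNormalized n x) (gaussianReal 0 1) := by
  have hpe : ∀ (k : ℕ) (x : ℝ),
      aeval x (hermite k) = ((hermite k).map (Int.castRingHom ℝ)).eval x :=
    fun k x => by rw [eval_map, aeval_def]; rfl
  refine ((integrable_eval_gaussianReal ((hermite m).map (Int.castRingHom ℝ) *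
    (hermite n).map (Int.castRingHom ℝ))).const_mul
      (Real.sqrt m.factorial * Real.sqrt n.factorial)⁻¹).congr
        (Filter.Eventually.of_forall fun x => ?_)
  simp only [hermiteNormalized, hpe, eval_mul]
  field_simp

theorem measurable_hermiteNormalized (k : ℕ) : Measurable (hermiteNormalized k) := by
  unfold hermiteNormalized
  exact ((hermite k).continuous_aeval).measurable.div_const _

theorem hermiteNormalized_zero (x : ℝ) : hermiteNormalized 0 x = 1 := by
  simp [hermiteNormalized]

variable {V : Type*} (G : SimpleGraph V) [Fintype G.edgeSet]

instance isProbabilityMeasure_couplingLaw : IsProbabilityMeasure (couplingLaw G) := by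
  unfold couplingLaw; infer_instance

theorem measurable_hermiteTensor (k : G.edgeSet → ℕ) : Measurable (hermiteTensor G k) :=
  Finset.measurable_prod _ fun e _ =>
    (measurable_hermiteNormalized (k e)).comp (measurable_pi_apply e)

theorem memLp_hermiteTensor (k : G.edgeSet → ℕ) :
    MemLp (hermiteTensor G k) 2 (couplingLaw G) := by
  rw [memLp_two_iff_integrable_sq (measurable_hermiteTensor G k).aestronglyMeasurable]
  have h := Integrable.fintype_prod (𝕜 := ℝ) (μ := fun _ : G.edgeSet => gaussianReal 0 1)
    (f := fun e x => hermiteNormalized (k e) x * hermiteNormalized (k e) x)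
    (fun e => integrable_hermiteNormalized_mul _ _)
  refine h.congr (Filter.Eventually.of_forall fun J => ?_)
  simp [hermiteTensor, Finset.prod_mul_distrib, sq]

theorem integral_hermiteTensor_mul (k l : G.edgeSet → ℕ) :
    ∫ J, hermiteTensor G k J * hermiteTensor G l J ∂(couplingLaw G) = if k = l then 1 else 0 := by
  have h := integral_fintype_prod_eq_prod (𝕜 := ℝ) (μ := fun _ : G.edgeSet => gaussianReal 0 1)
    (fun e x => hermiteNormalized (k e) x * hermiteNormalized (l e) x)
  simp only [integral_hermiteNormalized_mul] at h
  simp only [hermiteTensor, ← Finset.prod_mul_distrib, couplingLaw]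
  rw [h]
  split_ifs with hkl
  · subst hkl; simp
  · obtain ⟨e, he⟩ := Function.ne_iff.1 hkl
    exact Finset.prod_eq_zero (Finset.mem_univ e) (if_neg he)

/-- Bessel's inequality for the Hermite tensors. -/
theorem sum_sq_integral_mul_hermiteTensor_le {f : Couplings G → ℝ}
    (hf : MemLp f 2 (couplingLaw G)) (s : Finset (G.edgeSet → ℕ)) :
    ∑ k ∈ s, (∫ J, f J * hermiteTensor G k J ∂(couplingLaw G)) ^ 2 ≤
      ∫ J, f J ^ 2 ∂(couplingLaw G) := by
  have hinner : ∀ {g h : Couplings G → ℝ} (hg : MemLp g 2 (couplingLaw G))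
      (hh : MemLp h 2 (couplingLaw G)),
      inner ℝ (hg.toLp g) (hh.toLp h) = ∫ J, h J * g J ∂(couplingLaw G) := by
    intro g h hg hh
    rw [L2.inner_def]
    refine integral_congr_ae ?_
    filter_upwards [hg.coeFn_toLp, hh.coeFn_toLp] with J h1 h2
    simp [h1, h2]
  have hon : Orthonormal ℝ fun k => (memLp_hermiteTensor G k).toLp (hermiteTensor G k) := by
    classical
    rw [orthonormal_iff_ite]
    intro k l
    rw [hinner, integral_hermiteTensor_mul]
    simp [eq_comm]
  have h := hon.sum_inner_products_le (hf.toLp f) (s := s)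
  rw [← real_inner_self_eq_norm_sq, hinner] at h
  simpa [hinner, sq] using h

end Hermite

end EdwardsAnderson

namespace EdwardsAnderson

/-! ### Ground states: gauge transformations and dominating edges -/

section GroundStates

open MeasureTheory ProbabilityTheory

variable {V : Type*}

@[simp]
theorem bond_mk (σ : Spins V) (x y : V) : bond σ s(x, y) = σ x * σ y := rfl

theorem bond_mul (σ τ : Spins V) (e : Sym2 V) : bond (σ * τ) e = bond σ e * bond τ e := by
  induction e with
  | h x y => simp only [bond_mk, Pi.mul_apply]; exact mul_mul_mul_comm _ _ _ _

theorem bond_mulSingle [DecidableEq V] (x : V) {e : Sym2 V} (he : ¬ e.IsDiag) :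
    bond (Pi.mulSingle x (-1) : Spins V) e = if x ∈ e then -1 else 1 := by
  induction e with
  | h y z =>
    have hyz : y ≠ z := by simpa using he
    by_cases hy : x = y
    · subst hy
      simp [Pi.mulSingle_eq_of_ne hyz.symm]
    · by_cases hz : x = z
      · subst hz
        simp [Pi.mulSingle_eq_of_ne hyz]
      · simp [Ne.symm hy, Ne.symm hz, hy, hz]

variable (G : SimpleGraph V)

/-- Multiply each coupling by a prescribed sign. -/
def signFlip (s : G.edgeSet → ℤˣ) (J : Couplings G) : Couplings G :=
  fun e => ((s e : ℤ) : ℝ) * J e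

theorem abs_unit_cast (s : ℤˣ) : |((s : ℤ) : ℝ)| = 1 := by
  rcases Int.units_eq_one_or s with rfl | rfl <;> simp

theorem unit_cast_mul_self (s : ℤˣ) : ((s : ℤ) : ℝ) * ((s : ℤ) : ℝ) = 1 := by
  rcases Int.units_eq_one_or s with rfl | rfl <;> simp

@[simp]
theorem abs_signFlip (s : G.edgeSet → ℤˣ) (J : Couplings G) (e : G.edgeSet) :
    |signFlip G s J e| = |J e| := by
  simp [signFlip, abs_mul, abs_unit_cast]

variable [Fintype G.edgeSet]

theorem hamiltonian_signFlip_bond (η σ : Spins V) (J : Couplings G) :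
    hamiltonian G (signFlip G (fun e => bond η e) J) (η * σ) = hamiltonian G J σ := by
  unfold hamiltonian signFlip
  refine Finset.sum_congr rfl fun e _ => ?_
  rw [bond_mul]
  push_cast
  linear_combination (J e * ((bond σ (e : Sym2 V) : ℤ) : ℝ)) * unit_cast_mul_self (bond η e)

theorem hamiltonian_signFlip_mulSingle [DecidableEq G.edgeSet] (e : G.edgeSet) (σ : Spins V)
    (J : Couplings G) :
    hamiltonian G (signFlip G (Pi.mulSingle e (-1)) J) σ =
      hamiltonian G J σ - 2 * (J e * ((bond σ (e : Sym2 V) : ℤ) : ℝ)) := by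
  unfold hamiltonian signFlip
  rw [← Finset.add_sum_erase _ _ (Finset.mem_univ e),
    ← Finset.add_sum_erase (a := e) (f := fun e => J e * ((bond σ (e : Sym2 V) : ℤ) : ℝ)) _
      (Finset.mem_univ e)]
  have h : ∀ e' ∈ Finset.univ.erase e,
      (((Pi.mulSingle e (-1) : G.edgeSet → ℤˣ) e' : ℤ) : ℝ) * J e' *
        ((bond σ (e' : Sym2 V) : ℤ) : ℝ) = J e' * ((bond σ (e' : Sym2 V) : ℤ) : ℝ) := by
    intro e' he'
    simp [Pi.mulSingle_eq_of_ne (Finset.ne_of_mem_erase he')]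
  rw [Finset.sum_congr rfl h]
  simp
  ring

open Classical in
/-- The coupling on the edge `a` outweighs all the other couplings at its end `x` together. -/
def Dominates (J : Couplings G) (x : V) (a : G.edgeSet) : Prop :=
  x ∈ (a : Sym2 V) ∧ ∑ e ∈ Finset.univ.filter fun e : G.edgeSet => x ∈ (e : Sym2 V) ∧ e ≠ a, |J e| < |J a|

theorem Dominates.signFlip {G : SimpleGraph V} [Fintype G.edgeSet] {J : Couplings G} {x : V}
    {a : G.edgeSet} (h : Dominates G J x a) (s : G.edgeSet → ℤˣ) :
    Dominates G (signFlip G s J) x a := by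
  simpa [Dominates] using h

/-- Otherwise flipping the single spin at `x` would raise the energy: the change is governed by the
edges at `x` alone, and among these `a` decides the sign. -/
theorem IsGroundState.bond_pos {G : SimpleGraph V} [Fintype G.edgeSet] {J : Couplings G}
    {σ : Spins V} (h : IsGroundState G J σ) {x : V} {a : G.edgeSet} (ha : Dominates G J x a) :
    0 < J a * ((bond σ (a : Sym2 V) : ℤ) : ℝ) := by
  classical
  obtain ⟨hx, hs⟩ := ha
  have h1 := h (Pi.mulSingle x (-1) * σ)
  have h2 : hamiltonian G J σ - hamiltonian G J (Pi.mulSingle x (-1) * σ) =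
      2 * ∑ e ∈ Finset.univ.filter fun e : G.edgeSet => x ∈ (e : Sym2 V),
        J e * ((bond σ (e : Sym2 V) : ℤ) : ℝ) := by
    unfold hamiltonian
    rw [← Finset.sum_sub_distrib, Finset.mul_sum, Finset.sum_filter]
    refine Finset.sum_congr rfl fun e _ => ?_
    rw [bond_mul, bond_mulSingle x (G.not_isDiag_of_mem_edgeSet e.2)]
    split_ifs
    · simp; ring
    · simp
  have h3 : ∑ e ∈ Finset.univ.filter fun e : G.edgeSet => x ∈ (e : Sym2 V),
        J e * ((bond σ (e : Sym2 V) : ℤ) : ℝ) =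
      J a * ((bond σ (a : Sym2 V) : ℤ) : ℝ) +
        ∑ e ∈ Finset.univ.filter fun e : G.edgeSet => x ∈ (e : Sym2 V) ∧ e ≠ a,
          J e * ((bond σ (e : Sym2 V) : ℤ) : ℝ) := by
    rw [← Finset.add_sum_erase (a := a) _ _ (by simpa using hx)]
    congr 2
    ext e
    simp [and_comm]
  have h4 : ∑ e ∈ Finset.univ.filter fun e : G.edgeSet => x ∈ (e : Sym2 V) ∧ e ≠ a,
      J e * ((bond σ (e : Sym2 V) : ℤ) : ℝ) ≤
      ∑ e ∈ Finset.univ.filter fun e : G.edgeSet => x ∈ (e : Sym2 V) ∧ e ≠ a, |J e| :=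
    Finset.sum_le_sum fun e _ => by
      refine (le_abs_self _).trans ?_
      rw [abs_mul, abs_unit_cast, mul_one]
  have h5 : |J a * ((bond σ (a : Sym2 V) : ℤ) : ℝ)| = |J a| := by
    rw [abs_mul, abs_unit_cast, mul_one]
  by_contra hneg
  rw [abs_of_nonpos (not_lt.1 hneg)] at h5
  linarith

/-- Two ground states, for couplings that agree at `a`, agree on a dominating edge `a`. -/
theorem bond_eq_of_dominates {G : SimpleGraph V} [Fintype G.edgeSet] {J J' : Couplings G}
    {σ τ : Spins V} (hσ : IsGroundState G J σ) (hτ : IsGroundState G J' τ) {x : V}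
    {a : G.edgeSet} (ha : Dominates G J x a) (ha' : Dominates G J' x a) (hJ : J' a = J a) :
    bond σ (a : Sym2 V) = bond τ (a : Sym2 V) := by
  have h1 := hσ.bond_pos ha
  have h2 := hτ.bond_pos ha'
  rw [hJ] at h2
  rcases Int.units_eq_one_or (bond σ (a : Sym2 V)) with h | h <;>
    rcases Int.units_eq_one_or (bond τ (a : Sym2 V)) with h' | h' <;>
    rw [h, h'] <;> rw [h] at h1 <;> rw [h'] at h2 <;> simp at h1 h2 <;> linarith

/-- All ground states have the same bonds. -/
def UniqueBonds (J : Couplings G) : Prop :=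
  ∀ σ τ : Spins V, IsGroundState G J σ → IsGroundState G J τ →
    ∀ e : G.edgeSet, bond σ (e : Sym2 V) = bond τ (e : Sym2 V)

/-- A relative spin is the product of the bonds along any walk between the two vertices. -/
theorem mul_eq_mul_of_bond_eq {G : SimpleGraph V} (hG : G.Preconnected) {σ τ : Spins V}
    (h : ∀ e : G.edgeSet, bond σ (e : Sym2 V) = bond τ (e : Sym2 V)) (u v : V) :
    σ u * σ v = τ u * τ v := by
  obtain ⟨p⟩ := hG u v
  induction p with
  | nil => simp [← sq]
  | @cons x y z hxy _ ih =>
    have h1 := h ⟨s(x, y), hxy⟩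
    simp only [bond_mk] at h1
    calc σ x * σ z = (σ x * σ y) * (σ y * σ z) := by
          rw [mul_assoc, ← mul_assoc (σ y), Int.units_mul_self, one_mul]
      _ = (τ x * τ y) * (τ y * τ z) := by rw [h1, ih]
      _ = τ x * τ z := by rw [mul_assoc, ← mul_assoc (τ y), Int.units_mul_self, one_mul]

variable [Finite V]

theorem isGroundState_groundState (J : Couplings G) : IsGroundState G J (groundState G J) :=
  Classical.choose_spec (exists_isGroundState G J)

theorem relativeSpin_eq {G : SimpleGraph V} [Fintype G.edgeSet] (hG : G.Preconnected)
    {J : Couplings G} (hJ : UniqueBonds G J) {σ : Spins V} (hσ : IsGroundState G J σ) (u v : V) :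
    relativeSpin G u v J = ((σ u * σ v : ℤˣ) : ℤ) := by
  unfold relativeSpin
  rw [mul_eq_mul_of_bond_eq hG (hJ _ _ (isGroundState_groundState G J) hσ)]

theorem abs_relativeSpin (u v : V) (J : Couplings G) : |relativeSpin G u v J| = 1 :=
  abs_unit_cast _

/-- If the sign of the coupling on `e` does not affect the bond of the ground state across `e`,
then a gauge transformation by `η`, undone on the edge `e`, acts on relative spins as `η` does. -/
theorem relativeSpin_signFlip {G : SimpleGraph V} [Fintype G.edgeSet] [DecidableEq G.edgeSet]
    (hG : G.Preconnected) {J : Couplings G} (hJ : UniqueBonds G J) (η : Spins V) (e : G.edgeSet)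
    (he : ∀ σ τ, IsGroundState G J σ → IsGroundState G (signFlip G (Pi.mulSingle e (-1)) J) τ →
      bond σ (e : Sym2 V) = bond τ (e : Sym2 V)) (u v : V) :
    relativeSpin G u v
        (signFlip G (fun e' => bond η e' * (Pi.mulSingle e (-1) : G.edgeSet → ℤˣ) e') J) =
      ((η u * η v : ℤˣ) : ℤ) * relativeSpin G u v J := by
  set K := signFlip G (Pi.mulSingle e (-1)) J with hK
  have hT : signFlip G (fun e' => bond η e' * (Pi.mulSingle e (-1) : G.edgeSet → ℤˣ) e') J =
      signFlip G (fun e' => bond η e') K := by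
    ext e'
    simp [hK, signFlip, mul_assoc]
  rw [hT]
  set ρ := groundState G (signFlip G (fun e' => bond η e') K) with hρ
  have hρ' := isGroundState_groundState G (signFlip G (fun e' => bond η e') K)
  rw [← hρ] at hρ'
  have hηη : η * (η * ρ) = ρ := by
    ext x; simp [← mul_assoc, Int.units_mul_self]
  -- Gauge covariance: undoing `η` carries a ground state of the transformed couplings back to one
  -- for `K`.
  have hτ : IsGroundState G K (η * ρ) := by
    intro π
    rw [← hamiltonian_signFlip_bond G η, ← hamiltonian_signFlip_bond G η (η * ρ), hηη]
    exact hρ' _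
  -- The energies for `J` and `K` differ by a term in the bond across `e` only. That bond is common
  -- to `η * ρ` and the ground state of `J`, so optimality for `K` transfers to `J`.
  have hτJ : IsGroundState G J (η * ρ) := by
    intro π
    refine (isGroundState_groundState G J π).trans ?_
    have h1 := hτ (groundState G J)
    rw [hK, hamiltonian_signFlip_mulSingle, hamiltonian_signFlip_mulSingle,
      he _ _ (isGroundState_groundState G J) hτ] at h1
    linarith
  rw [relativeSpin_eq hG hJ hτJ]
  unfold relativeSpin
  rw [← hρ]
  norm_cast
  simp only [Pi.mul_apply]
  rw [mul_mul_mul_comm (η u) (ρ u), ← mul_assoc, Int.units_mul_self, one_mul]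

/-- A dominating three-edge path parallel to `e` fixes the bond across `e`. -/
theorem relativeSpin_signFlip_of_dominates {G : SimpleGraph V} [Fintype G.edgeSet]
    [DecidableEq G.edgeSet]
    (hG : G.Preconnected) {J : Couplings G} (hJ : UniqueBonds G J) (η : Spins V)
    {e a b c : G.edgeSet} (hae : a ≠ e) (hbe : b ≠ e) (hce : c ≠ e) {x y z : V}
    (ha : Dominates G J x a) (hb : Dominates G J y b) (hc : Dominates G J z c)
    (hcycle : ∀ σ : Spins V, bond σ (e : Sym2 V) =
      bond σ (a : Sym2 V) * bond σ (b : Sym2 V) * bond σ (c : Sym2 V)) (u v : V) :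
    relativeSpin G u v
        (signFlip G (fun e' => bond η e' * (Pi.mulSingle e (-1) : G.edgeSet → ℤˣ) e') J) =
      ((η u * η v : ℤˣ) : ℤ) * relativeSpin G u v J := by
  refine relativeSpin_signFlip hG hJ η e (fun σ τ hσ hτ => ?_) u v
  have key : ∀ {d : G.edgeSet} {w : V}, d ≠ e → Dominates G J w d →
      bond σ (d : Sym2 V) = bond τ (d : Sym2 V) := fun hd hw =>
    bond_eq_of_dominates hσ hτ hw (hw.signFlip _) (by simp [signFlip, Pi.mulSingle_eq_of_ne hd])
  rw [hcycle, hcycle, key hae ha, key hbe hb, key hce hc]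

end GroundStates

/-! ### The Gaussian law: almost sure uniqueness, sign symmetry, measurability -/

section Law

open MeasureTheory ProbabilityTheory

variable {V : Type*} (G : SimpleGraph V) [Fintype G.edgeSet]

/-- With all coordinates but `i` frozen, the slice is a single point, which is null. -/
theorem measure_pi_hyperplane_eq_zero {ι : Type*} [Fintype ι] (μ : ι → Measure ℝ)
    [∀ i, IsProbabilityMeasure (μ i)] [∀ i, NullSingletonClass (μ i)] (c : ι → ℝ) {i : ι}
    (hi : c i ≠ 0) : Measure.pi μ {x | ∑ j, c j * x j = 0} = 0 := by
  classical
  have hm : MeasurableSet {x : ι → ℝ | ∑ j, c j * x j = 0} :=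
    measurableSet_eq_fun (by fun_prop) measurable_const
  rw [← lintegral_indicator_one hm]
  have h := lintegral_eq_of_lmarginal_eq (μ := μ) {i} (f := Set.indicator
    {x : ι → ℝ | ∑ j, c j * x j = 0} 1) (g := 0) (measurable_one.indicator hm)
    measurable_zero ?_
  · rw [h]; simp
  · rw [lmarginal_singleton, lmarginal_singleton]
    ext x
    simp only [Pi.zero_apply, lintegral_zero]
    have hs : ∀ t : ℝ, Set.indicator {x : ι → ℝ | ∑ j, c j * x j = 0} (1 : (ι → ℝ) → ENNReal)
        (Function.update x i t) =
        Set.indicator {-(∑ j ∈ Finset.univ.erase i, c j * x j) / c i} 1 t := by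
      intro t
      have : (Function.update x i t ∈ {x : ι → ℝ | ∑ j, c j * x j = 0}) ↔
          t ∈ ({-(∑ j ∈ Finset.univ.erase i, c j * x j) / c i} : Set ℝ) := by
        rw [Set.mem_ofPred_eq, Set.mem_singleton_iff,
          ← Finset.add_sum_erase _ _ (Finset.mem_univ i), eq_div_iff hi]
        have : ∑ j ∈ Finset.univ.erase i, c j * Function.update x i t j =
            ∑ j ∈ Finset.univ.erase i, c j * x j :=
          Finset.sum_congr rfl fun j hj => by
            rw [Function.update_of_ne (Finset.ne_of_mem_erase hj)]
        rw [this, Function.update_self]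
        constructor <;> intro h <;> linarith
      simp only [Set.indicator, this, Pi.one_apply]
    simp only [hs]
    rw [lintegral_indicator_one (measurableSet_singleton _)]
    exact measure_singleton _

theorem measurable_hamiltonian (σ : Spins V) : Measurable fun J => hamiltonian G J σ := by
  unfold hamiltonian; fun_prop

theorem measurePreserving_signFlip (s : G.edgeSet → ℤˣ) :
    MeasurePreserving (signFlip G s) (couplingLaw G) (couplingLaw G) := by
  refine measurePreserving_pi _ _ (f := fun e t => ((s e : ℤ) : ℝ) * t) fun e => ?_
  rcases Int.units_eq_one_or (s e) with h | h
  · simpa [h, Function.id_def] using MeasurePreserving.id (gaussianReal 0 1)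
  · refine ⟨by fun_prop, ?_⟩
    have := gaussianReal_map_neg (μ := 0) (v := 1)
    simpa [h] using this

variable [Finite V]

/-- Two configurations that differ in some bond have equal energy only for `J` in a hyperplane, and
there are countably many pairs. -/
theorem ae_uniqueBonds : ∀ᵐ J ∂(couplingLaw G), UniqueBonds G J := by
  have : Countable (Spins V) := inferInstance
  have := nullSingletonClass_gaussianReal (μ := 0) (v := 1) one_ne_zero
  have h : ∀ᵐ J ∂(couplingLaw G), ∀ σ τ : Spins V, ∀ e : G.edgeSet,
      bond σ (e : Sym2 V) ≠ bond τ (e : Sym2 V) → hamiltonian G J σ ≠ hamiltonian G J τ := by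
    simp only [ae_all_iff]
    intro σ τ e hne
    have h0 := measure_pi_hyperplane_eq_zero (fun _ : G.edgeSet => gaussianReal 0 1)
      (fun e => ((bond σ (e : Sym2 V) : ℤ) : ℝ) - ((bond τ (e : Sym2 V) : ℤ) : ℝ)) (i := e)
      (by
        rw [sub_ne_zero]
        exact_mod_cast fun h => hne (Units.ext h))
    rw [ae_iff]
    refine measure_mono_null (fun J hJ => ?_) h0
    have hJ' : hamiltonian G J σ = hamiltonian G J τ := by simpa using hJ
    rw [Set.mem_ofPred_eq, ← sub_eq_zero.2 hJ', hamiltonian, hamiltonian,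
      ← Finset.sum_sub_distrib]
    exact Finset.sum_congr rfl fun _ _ => by ring
  filter_upwards [h] with J hJ σ τ hσ hτ e
  by_contra hne
  exact hJ σ τ e hne (le_antisymm (hτ σ) (hσ τ))

/-- The ground state is an arbitrary choice, so measurability is obtained only almost everywhere:
where bonds are unique, the relative spin is decided by whether some maximizer has `σ u * σ v = 1`,
a condition given by comparing energies. -/
theorem aestronglyMeasurable_relativeSpin (hG : G.Preconnected) (u v : V) :
    AEStronglyMeasurable (relativeSpin G u v) (couplingLaw G) := by
  classical
  have hS : MeasurableSet {J : Couplings G | ∃ σ : Spins V, σ u * σ v = 1 ∧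
      ∀ τ : Spins V, hamiltonian G J τ ≤ hamiltonian G J σ} := by
    have : {J : Couplings G | ∃ σ : Spins V, σ u * σ v = 1 ∧
        ∀ τ : Spins V, hamiltonian G J τ ≤ hamiltonian G J σ} =
        ⋃ σ : Spins V, ⋃ _ : σ u * σ v = 1, ⋂ τ : Spins V,
          {J | hamiltonian G J τ ≤ hamiltonian G J σ} := by
      ext J; simp
    rw [this]
    exact MeasurableSet.iUnion fun σ => MeasurableSet.iUnion fun _ => MeasurableSet.iInter fun τ =>
      measurableSet_le (measurable_hamiltonian G τ) (measurable_hamiltonian G σ)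
  have hg : Measurable fun J : Couplings G => if J ∈ {J : Couplings G | ∃ σ : Spins V,
      σ u * σ v = 1 ∧ ∀ τ : Spins V, hamiltonian G J τ ≤ hamiltonian G J σ} then (1 : ℝ) else -1 :=
    Measurable.ite hS measurable_const measurable_const
  refine (hg.aestronglyMeasurable (μ := couplingLaw G)).congr ?_
  filter_upwards [ae_uniqueBonds G] with J hJ
  split_ifs with hmem
  · obtain ⟨σ, h1, hσ⟩ := hmem
    rw [relativeSpin_eq hG hJ hσ, h1]
    simp
  · rcases Int.units_eq_one_or (groundState G J u * groundState G J v) with h | h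
    · exact absurd ⟨_, h, isGroundState_groundState G J⟩ hmem
    · simp [relativeSpin, h]

end Law

end EdwardsAnderson

namespace EdwardsAnderson

/-! ### Independence of boxes with disjoint sets of constrained coordinates -/

section Boxes

open MeasureTheory ProbabilityTheory

/-- At most one of the sets is not the whole space, so both sides reduce to its measure, or to 1. -/
theorem measure_iInter_eq_prod_of_pairwise_univ {ι Ω : Type*} [MeasurableSpace Ω]
    (μ : Measure Ω) [IsProbabilityMeasure μ] (X : ι → Set Ω)
    (hX : Pairwise fun i j => X i = Set.univ ∨ X j = Set.univ) (s : Finset ι) :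
    μ (⋂ i ∈ s, X i) = ∏ i ∈ s, μ (X i) := by
  classical
  induction s using Finset.induction_on with
  | empty => simp
  | insert i s hi ih =>
    rw [Finset.prod_insert hi, Finset.set_biInter_insert]
    by_cases h : X i = Set.univ
    · rw [h, Set.univ_inter, measure_univ, one_mul, ih]
    · have hs : ∀ j ∈ s, X j = Set.univ := fun j hj =>
        (hX (fun hij : i = j => hi (hij ▸ hj))).resolve_left h
      rw [Set.iInter₂_congr hs, Finset.prod_congr rfl fun j hj => by rw [hs j hj]]
      simp

/-- Boxes in a product space that constrain pairwise disjoint sets of coordinates are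
independent. -/
theorem iIndepSet_pi_of_pairwise_univ {ι κ : Type*} [Fintype κ] {Ω : κ → Type*}
    [∀ e, MeasurableSpace (Ω e)] (μ : ∀ e, Measure (Ω e)) [∀ e, IsProbabilityMeasure (μ e)]
    (X : ι → ∀ e, Set (Ω e)) (hXm : ∀ i e, MeasurableSet (X i e))
    (hX : ∀ e, Pairwise fun i j => X i e = Set.univ ∨ X j e = Set.univ) :
    iIndepSet (fun i => Set.univ.pi (X i)) (Measure.pi μ) := by
  rw [iIndepSet_iff_meas_biInter fun i => MeasurableSet.univ_pi (hXm i)]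
  intro s
  have h : (⋂ i ∈ s, Set.univ.pi (X i)) = Set.univ.pi fun e => ⋂ i ∈ s, X i e := by
    ext x; simp only [Set.mem_iInter, Set.mem_pi, Set.mem_univ, true_imp_iff]; tauto
  rw [h, Measure.pi_pi]
  simp only [Measure.pi_pi]
  rw [Finset.prod_comm]
  exact Finset.prod_congr rfl fun e _ =>
    measure_iInter_eq_prod_of_pairwise_univ (μ e) (fun i => X i e) (hX e) s

theorem measure_iInter_compl_le {ι Ω : Type*} [MeasurableSpace Ω] {μ : Measure Ω}
    {A : ι → Set Ω} (hA : iIndepSet A μ) (hAm : ∀ i, MeasurableSet (A i)) {p : ENNReal}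
    (hp : ∀ i, p ≤ μ (A i)) (s : Finset ι) :
    μ (⋂ i ∈ s, (A i)ᶜ) ≤ (1 - p) ^ s.card := by
  have := hA.isProbabilityMeasure
  rw [iIndepSet_iff_iIndep] at hA
  rw [hA.meas_biInter fun i _ => (MeasurableSpace.measurableSet_generateFrom
    (Set.mem_singleton (A i))).compl]
  refine Finset.prod_le_pow_card _ _ _ fun i _ => ?_
  rw [prob_compl_eq_one_sub (hAm i)]
  exact tsub_le_tsub_left (hp i) 1

end Boxes

/-! ### Cancellation of Fourier-Hermite coefficients and the spectral bound -/

section Spectral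

open MeasureTheory ProbabilityTheory

theorem integral_eq_zero_of_comp_eq_neg {Ω : Type*} [MeasurableSpace Ω] {μ : Measure Ω}
    {T : Ω → Ω} (hT : MeasurePreserving T μ μ) {F : Ω → ℝ} (hF : AEStronglyMeasurable F μ)
    (h : ∀ᵐ x ∂μ, F (T x) = -F x) : ∫ x, F x ∂μ = 0 := by
  have h1 : ∫ x, F (T x) ∂μ = ∫ x, F x ∂μ := by
    have hF' : AEStronglyMeasurable F (μ.map T) := by rwa [hT.map_eq]
    have := integral_map hT.measurable.aemeasurable hF'
    rw [hT.map_eq] at this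
    exact this.symm
  rw [integral_congr_ae h, integral_neg] at h1
  linarith

variable {V : Type*} (G : SimpleGraph V) [Fintype G.edgeSet]

theorem hermiteTensor_signFlip {k : G.edgeSet → ℕ} {s : G.edgeSet → ℤˣ}
    (h : ∀ e, 1 ≤ k e → s e = 1) (J : Couplings G) :
    hermiteTensor G k (signFlip G s J) = hermiteTensor G k J := by
  refine Finset.prod_congr rfl fun e _ => ?_
  rcases Nat.eq_zero_or_pos (k e) with h0 | h0
  · rw [h0, hermiteNormalized_zero, hermiteNormalized_zero]
  · simp [signFlip, h e h0]

variable [Finite V]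

theorem memLp_indicator_relativeSpin (hG : G.Preconnected) (u v : V) {S : Set (Couplings G)}
    (hS : MeasurableSet S) :
    MemLp (S.indicator (relativeSpin G u v)) 2 (couplingLaw G) := by
  refine MemLp.indicator hS (MemLp.of_bound (aestronglyMeasurable_relativeSpin G hG u v) 1 ?_)
  exact Filter.Eventually.of_forall fun J => (abs_relativeSpin G u v J).le

/-- The events are removed one at a time. Their invariance under all sign changes is essential: the
flip for `A m` must preserve the complements already cut out, although it may change couplings near
the other events. -/
theorem fourierCoeff_eq_integral_indicator (hG : G.Preconnected) (u v : V)
    (A : ℕ → Set (Couplings G)) (hAm : ∀ i, MeasurableSet (A i))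
    (hA : ∀ i s J, signFlip G s J ∈ A i ↔ J ∈ A i) (s : ℕ → G.edgeSet → ℤˣ)
    (k : G.edgeSet → ℕ) (m : ℕ) (hs : ∀ i < m, ∀ e, 1 ≤ k e → s i e = 1)
    (hflip : ∀ i < m, ∀ J ∈ A i, UniqueBonds G J →
      relativeSpin G u v (signFlip G (s i) J) = -relativeSpin G u v J) :
    fourierCoeff G u v k =
      ∫ J, (⋂ i ∈ Finset.range m, (A i)ᶜ).indicator (relativeSpin G u v) J *
        hermiteTensor G k J ∂(couplingLaw G) := by
  classical
  induction m with
  | zero => simp [fourierCoeff]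
  | succ m ih =>
    rw [ih (fun i hi => hs i (by omega)) (fun i hi => hflip i (by omega))]
    set N : Set (Couplings G) := ⋂ i ∈ Finset.range m, (A i)ᶜ with hN
    have hNm : MeasurableSet N := Finset.measurableSet_biInter _ fun i _ => (hAm i).compl
    have hN' : (⋂ i ∈ Finset.range (m + 1), (A i)ᶜ) = N \ A m := by
      rw [Finset.range_add_one, Finset.set_biInter_insert, Set.inter_comm, Set.sdiff_eq]
    have hNinv : ∀ s J, signFlip G s J ∈ N ↔ J ∈ N := by
      intro s J
      simp [hN, hA]
    have hint : ∀ {S : Set (Couplings G)}, MeasurableSet S →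
        Integrable (fun J => S.indicator (relativeSpin G u v) J * hermiteTensor G k J)
          (couplingLaw G) := fun hS =>
      (memLp_indicator_relativeSpin G hG u v hS).integrable_mul (memLp_hermiteTensor G k)
    -- The flip `s m` preserves the law, the set `N ∩ A m` and the tensor, and negates the relative
    -- spin almost everywhere on that set.
    have hzero : ∫ J, (N ∩ A m).indicator (relativeSpin G u v) J *
        hermiteTensor G k J ∂(couplingLaw G) = 0 := by
      refine integral_eq_zero_of_comp_eq_neg (measurePreserving_signFlip G (s m))
        (hint (hNm.inter (hAm m))).aestronglyMeasurable ?_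
      filter_upwards [ae_uniqueBonds G] with J hJ
      rw [hermiteTensor_signFlip G (hs m (by omega))]
      by_cases hmem : J ∈ N ∩ A m
      · have hmem' : signFlip G (s m) J ∈ N ∩ A m := ⟨(hNinv _ _).2 hmem.1, (hA _ _ _).2 hmem.2⟩
        rw [Set.indicator_of_mem hmem, Set.indicator_of_mem hmem',
          hflip m (by omega) J hmem.2 hJ, neg_mul]
      · have hmem' : signFlip G (s m) J ∉ N ∩ A m := fun h =>
          hmem ⟨(hNinv _ _).1 h.1, (hA _ _ _).1 h.2⟩
        rw [Set.indicator_of_notMem hmem, Set.indicator_of_notMem hmem']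
        simp
    rw [hN', ← add_zero (∫ J, (N \ A m).indicator _ J * _ ∂_), ← hzero,
      ← integral_add (hint (hNm.diff (hAm m))) (hint (hNm.inter (hAm m)))]
    congr 1
    ext J
    by_cases h1 : J ∈ N <;> by_cases h2 : J ∈ A m <;> simp [h1, h2]

/-- The spectral mass of `S` is at most the probability that none of the events `A i` occurs, if
each `A i` allows a change of signs off `S` which negates the relative spin. -/
theorem spectralMass_le_measure_iInter_compl (hG : G.Preconnected) (u v : V) (S : Set G.edgeSet)
    (A : ℕ → Set (Couplings G)) (hAm : ∀ i, MeasurableSet (A i))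
    (hA : ∀ i s J, signFlip G s J ∈ A i ↔ J ∈ A i) (s : ℕ → G.edgeSet → ℤˣ) (m : ℕ)
    (hs : ∀ i < m, ∀ e ∈ S, s i e = 1)
    (hflip : ∀ i < m, ∀ J ∈ A i, UniqueBonds G J →
      relativeSpin G u v (signFlip G (s i) J) = -relativeSpin G u v J) :
    spectralMass G u v S ≤ couplingLaw G (⋂ i ∈ Finset.range m, (A i)ᶜ) := by
  classical
  set N : Set (Couplings G) := ⋂ i ∈ Finset.range m, (A i)ᶜ with hN
  have hNm : MeasurableSet N := Finset.measurableSet_biInter _ fun i _ => (hAm i).compl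
  have hK : MeasurableSet {k : G.edgeSet → ℕ | indexSupport G k = S} :=
    (Set.to_countable _).measurableSet
  unfold spectralMass spectralMeasure
  rw [Measure.sum_apply _ hK]
  refine ENNReal.summable.tsum_le_of_sum_le fun t => ?_
  -- The relative spin is ±1, so the squared norm in Bessel's inequality is just the probability of
  -- `N`.
  have hsq : ∫ J, N.indicator (relativeSpin G u v) J ^ 2 ∂(couplingLaw G) =
      (couplingLaw G).real N := by
    rw [← integral_indicator_one hNm]
    congr 1
    ext J
    by_cases hJ : J ∈ N
    · simp [hJ, ← sq_abs (relativeSpin G u v J), abs_relativeSpin]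
    · simp [hJ]
  calc ∑ k ∈ t, (ENNReal.ofReal (fourierCoeff G u v k ^ 2) • Measure.dirac k)
        {k | indexSupport G k = S}
      = ∑ k ∈ t.filter (fun k => indexSupport G k = S),
          ENNReal.ofReal (fourierCoeff G u v k ^ 2) := by
        rw [Finset.sum_filter]
        refine Finset.sum_congr rfl fun k _ => ?_
        rw [Measure.smul_apply, Measure.dirac_apply' _ hK]
        by_cases hk : indexSupport G k = S <;> simp [hk]
    _ = ∑ k ∈ t.filter (fun k => indexSupport G k = S),
          ENNReal.ofReal ((∫ J, N.indicator (relativeSpin G u v) J *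
            hermiteTensor G k J ∂(couplingLaw G)) ^ 2) := by
        refine Finset.sum_congr rfl fun k hk => ?_
        have hk' : indexSupport G k = S := (Finset.mem_filter.1 hk).2
        rw [fourierCoeff_eq_integral_indicator G hG u v A hAm hA s k m
          (fun i hi e he => hs i hi e (hk' ▸ he)) hflip]
    _ = ENNReal.ofReal (∑ k ∈ t.filter (fun k => indexSupport G k = S),
          (∫ J, N.indicator (relativeSpin G u v) J *
            hermiteTensor G k J ∂(couplingLaw G)) ^ 2) :=
        (ENNReal.ofReal_sum_of_nonneg fun _ _ => sq_nonneg _).symm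
    _ ≤ ENNReal.ofReal ((couplingLaw G).real N) := by
        rw [← hsq]
        exact ENNReal.ofReal_le_ofReal (sum_sq_integral_mul_hermiteTensor_le G
          (memLp_indicator_relativeSpin G hG u v hNm) _)
    _ = couplingLaw G N := ofReal_measureReal

end Spectral

end EdwardsAnderson

namespace EdwardsAnderson

/-! ### Plaquettes of the grid: independence, probability, and the sign flip -/

section GridGeometry

open MeasureTheory ProbabilityTheory

variable {n : ℕ}

theorem grid_preconnected (n : ℕ) : (grid n).Preconnected := by
  have h : (SimpleGraph.pathGraph n).Preconnected := SimpleGraph.pathGraph_preconnected n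
  exact h.boxProd h

theorem grid_adj_iff {x y : Fin n × Fin n} :
    (grid n).Adj x y ↔
      (((x.1 : ℕ) + 1 = y.1 ∨ (y.1 : ℕ) + 1 = x.1) ∧ (x.2 : ℕ) = y.2) ∨
        (((x.2 : ℕ) + 1 = y.2 ∨ (y.2 : ℕ) + 1 = x.2) ∧ (x.1 : ℕ) = y.1) := by
  simp only [grid, SimpleGraph.boxProd_adj, SimpleGraph.pathGraph_adj, Fin.ext_iff]

theorem grid_card_incident_le (x : Fin n × Fin n) [DecidablePred fun e : (grid n).edgeSet =>
    x ∈ (e : Sym2 (Fin n × Fin n))] :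
    (Finset.univ.filter fun e : (grid n).edgeSet => x ∈ (e : Sym2 (Fin n × Fin n))).card ≤ 4 := by
  classical
  have hpath : ∀ i : Fin n, (SimpleGraph.pathGraph n).degree i ≤ 2 := by
    intro i
    refine le_trans (Finset.card_le_card_of_injOn (t := {(i : ℕ) + 1, (i : ℕ) - 1}) Fin.val
      (fun y hy => ?_) Fin.val_injective.injOn) Finset.card_le_two
    have hy' : (SimpleGraph.pathGraph n).Adj i y := by simpa using hy
    rw [SimpleGraph.pathGraph_adj] at hy'
    simp only [Finset.coe_insert, Finset.coe_singleton, Set.mem_insert_iff,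
      Set.mem_singleton_iff]
    omega
  have hdeg : (grid n).degree x ≤ 4 := by
    have h := SimpleGraph.degree_boxProd (G := SimpleGraph.pathGraph n)
      (H := SimpleGraph.pathGraph n) x
    have h1 := hpath x.1
    have h2 := hpath x.2
    have h3 : (grid n).degree x =
        (SimpleGraph.pathGraph n).degree x.1 + (SimpleGraph.pathGraph n).degree x.2 := by
      rw [← h]; unfold grid; congr!
    omega
  rw [← SimpleGraph.card_incidenceFinset_eq_degree] at hdeg
  refine le_trans (Finset.card_le_card_of_injOn Subtype.val (fun e he => ?_)
    Subtype.val_injective.injOn) hdeg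
  simp only [Finset.coe_filter, Finset.mem_univ, true_and] at he
  simpa using ⟨e.2, he⟩

theorem grid_dominates {J : Couplings (grid n)} {x : Fin n × Fin n} {a : (grid n).edgeSet} {M : ℝ}
    (hM : 0 ≤ M) (hx : x ∈ (a : Sym2 (Fin n × Fin n)))
    (hle : ∀ e : (grid n).edgeSet, x ∈ (e : Sym2 (Fin n × Fin n)) → e ≠ a → |J e| ≤ M)
    (ha : 4 * M < |J a|) : Dominates (grid n) J x a := by
  classical
  refine ⟨hx, lt_of_le_of_lt ?_ ha⟩
  refine (Finset.sum_le_card_nsmul _ _ M fun e he => ?_).trans ?_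
  · simp only [Finset.mem_filter, Finset.mem_univ, true_and] at he
    exact hle e he.1 he.2
  · rw [nsmul_eq_mul]
    refine mul_le_mul_of_nonneg_right ?_ hM
    refine (Nat.cast_le.2 ((Finset.card_le_card fun e he => ?_).trans
      (grid_card_incident_le x))).trans (by norm_num)
    simp only [Finset.mem_filter, Finset.mem_univ, true_and] at he ⊢
    exact he.1

/-- The four corners of the plaquette above the horizontal edge at height `r` (counted from `0`)
that starts in column `3 * i`. -/
def IsCorner (r i : ℕ) (w : Fin n × Fin n) : Prop :=
  ((w.1 : ℕ) = 3 * i ∨ (w.1 : ℕ) = 3 * i + 1) ∧ ((w.2 : ℕ) = r ∨ (w.2 : ℕ) = r + 1)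

open Classical in
/-- The constraints on the couplings around the plaquette `IsCorner r i`: strong couplings on the
vertical sides, a stronger one on the top side, and weak ones on all other edges at its corners. -/
noncomputable def plaquetteWindow (r i : ℕ) (e : (grid n).edgeSet) : Set ℝ :=
  if ∃ w ∈ (e : Sym2 (Fin n × Fin n)), IsCorner r i w then
    if ∀ w ∈ (e : Sym2 (Fin n × Fin n)), IsCorner r i w ∧ (w.2 : ℕ) = r + 1 then {t | 20 < |t|}
    else if (∀ w ∈ (e : Sym2 (Fin n × Fin n)), IsCorner r i w) ∧
        (∃ w ∈ (e : Sym2 (Fin n × Fin n)), (w.2 : ℕ) = r) ∧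
        (∃ w ∈ (e : Sym2 (Fin n × Fin n)), (w.2 : ℕ) = r + 1) then {t | 4 < |t| ∧ |t| < 5}
    else {t | |t| ≤ 1}
  else Set.univ

/-- The couplings satisfying the constraints around the plaquette `IsCorner r i`. -/
def plaquetteEvent (n r i : ℕ) : Set (Couplings (grid n)) :=
  Set.univ.pi (plaquetteWindow r i)

theorem measurableSet_plaquetteWindow (r i : ℕ) (e : (grid n).edgeSet) :
    MeasurableSet (plaquetteWindow r i e) := by
  have habs : Measurable fun t : ℝ => |t| := measurable_norm
  unfold plaquetteWindow
  split_ifs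
  · exact measurableSet_lt measurable_const habs
  · exact (measurableSet_lt measurable_const habs).inter (measurableSet_lt habs measurable_const)
  · exact measurableSet_le habs measurable_const
  · exact MeasurableSet.univ

theorem mem_plaquetteWindow_of_abs_eq {r i : ℕ} {e : (grid n).edgeSet} {s t : ℝ}
    (h : |s| = |t|) : s ∈ plaquetteWindow r i e ↔ t ∈ plaquetteWindow r i e := by
  unfold plaquetteWindow
  split_ifs <;> simp [h]

theorem signFlip_mem_plaquetteEvent (r i : ℕ) (s : (grid n).edgeSet → ℤˣ)
    (J : Couplings (grid n)) :
    signFlip (grid n) s J ∈ plaquetteEvent n r i ↔ J ∈ plaquetteEvent n r i := by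
  simp only [plaquetteEvent, Set.mem_univ_pi]
  exact forall_congr' fun e => mem_plaquetteWindow_of_abs_eq (abs_signFlip _ s J e)

theorem measurableSet_plaquetteEvent (n r i : ℕ) : MeasurableSet (plaquetteEvent n r i) :=
  MeasurableSet.univ_pi fun e => measurableSet_plaquetteWindow r i e

theorem iIndepSet_plaquetteEvent (n r : ℕ) :
    ProbabilityTheory.iIndepSet (plaquetteEvent n r) (couplingLaw (grid n)) := by
  refine iIndepSet_pi_of_pairwise_univ _ _ (fun i e => measurableSet_plaquetteWindow r i e) ?_
  intro e i j hij
  by_contra hcon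
  rw [not_or] at hcon
  have key : ∀ l, plaquetteWindow r l e ≠ Set.univ →
      ∃ w ∈ (e : Sym2 (Fin n × Fin n)), IsCorner r l w := fun l hl => by
    by_contra h
    exact hl (if_neg h)
  obtain ⟨w, hw, hwi⟩ := key i hcon.1
  obtain ⟨z, hz, hzj⟩ := key j hcon.2
  obtain ⟨e, he⟩ := e
  induction e with
  | h x y =>
    have hadj := grid_adj_iff.1 ((SimpleGraph.mem_edgeSet _).1 he)
    simp only [Sym2.mem_iff] at hw hz
    unfold IsCorner at hwi hzj
    -- Corners of distinct plaquettes are at least two columns apart, so no edge touches both. This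
    -- is why plaquettes are spaced by 3.
    rcases hw with rfl | rfl <;> rcases hz with rfl | rfl <;> omega

/-- A lower bound for the probability that one coupling satisfies its constraint. -/
noncomputable def windowProb : ENNReal :=
  min (gaussianReal 0 1 (Set.Ioo 20 21))
    (min (gaussianReal 0 1 (Set.Ioo 4 5)) (gaussianReal 0 1 (Set.Ioo 0 1)))

theorem windowProb_pos : 0 < windowProb := by
  have h : ∀ a b : ℝ, a < b → 0 < gaussianReal 0 1 (Set.Ioo a b) := by
    intro a b hab
    rw [pos_iff_ne_zero]
    intro h0
    have := gaussianReal_absolutelyContinuous' 0 one_ne_zero h0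
    simp [Real.volume_Ioo] at this
    linarith
  exact lt_min (h _ _ (by norm_num)) (lt_min (h _ _ (by norm_num)) (h _ _ (by norm_num)))

theorem windowProb_le_one : windowProb ≤ 1 := (min_le_left _ _).trans prob_le_one

theorem windowProb_le (r i : ℕ) (e : (grid n).edgeSet) :
    windowProb ≤ gaussianReal 0 1 (plaquetteWindow r i e) := by
  unfold plaquetteWindow
  split_ifs
  · refine (min_le_left _ _).trans (measure_mono fun t ht => ?_)
    exact lt_of_lt_of_le ht.1 (le_abs_self t)
  · refine (min_le_right _ _).trans ((min_le_left _ _).trans (measure_mono fun t ht => ?_))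
    have : |t| = t := abs_of_pos (by linarith [ht.1])
    exact ⟨this.symm ▸ ht.1, this.symm ▸ ht.2⟩
  · refine (min_le_right _ _).trans ((min_le_right _ _).trans (measure_mono fun t ht => ?_))
    have : |t| = t := abs_of_pos ht.1
    exact this.trans_le ht.2.le
  · rw [measure_univ]
    exact windowProb_le_one

/-- At most four corners with at most four edges each leave at most 16 constrained edges. -/
theorem windowProb_pow_le_measure_plaquetteEvent (n r i : ℕ) :
    windowProb ^ 16 ≤ couplingLaw (grid n) (plaquetteEvent n r i) := by
  classical
  set C : Finset (Fin n × Fin n) := Finset.univ.filter (IsCorner r i) with hC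
  have hCcard : C.card ≤ 4 := by
    refine (Finset.card_le_card_of_injOn (t := ({3 * i, 3 * i + 1} : Finset ℕ) ×ˢ {r, r + 1})
      (fun w => ((w.1 : ℕ), (w.2 : ℕ))) (fun w hw => ?_) ?_).trans ?_
    · have hw' : IsCorner r i w := by simpa [hC] using hw
      simpa [IsCorner] using hw'
    · intro w _ z _ h
      simpa [Prod.ext_iff, Fin.ext_iff] using h
    · rw [Finset.card_product]
      exact Nat.mul_le_mul Finset.card_le_two Finset.card_le_two
  set T : Finset (grid n).edgeSet :=
    Finset.univ.filter fun e => ∃ w ∈ (e : Sym2 (Fin n × Fin n)), IsCorner r i w with hT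
  have hTcard : T.card ≤ 16 := by
    have hsub : T ⊆ C.biUnion fun w => Finset.univ.filter fun e : (grid n).edgeSet =>
        w ∈ (e : Sym2 (Fin n × Fin n)) := by
      intro e he
      obtain ⟨w, hw, hwc⟩ := (Finset.mem_filter.1 he).2
      exact Finset.mem_biUnion.2 ⟨w, by simpa [hC] using hwc, by simpa using hw⟩
    refine (Finset.card_le_card hsub).trans ((Finset.card_biUnion_le_card_mul _ _ 4
      fun w _ => grid_card_incident_le w).trans ?_)
    omega
  unfold couplingLaw plaquetteEvent
  rw [Measure.pi_pi]
  calc windowProb ^ 16 ≤ windowProb ^ T.card := pow_le_pow_right_of_le_one' windowProb_le_one hTcard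
    _ = ∏ e, if e ∈ T then windowProb else 1 := by
        rw [Finset.prod_ite_mem, Finset.univ_inter, Finset.prod_const]
    _ ≤ _ := by
        refine Finset.prod_le_prod' fun e _ => ?_
        split_ifs with he
        · exact windowProb_le r i e
        · have : plaquetteWindow r i e = Set.univ := if_neg (by simpa [hT] using he)
          rw [this, measure_univ]

/-- The gauge transformation negating all spins to the right of column `l`. -/
def rightHalf (n l : ℕ) : Spins (Fin n × Fin n) := fun w => if (w.1 : ℕ) ≤ l then 1 else -1

/-- The horizontal edge at height `r` that starts in column `l` (both counted from `0`). -/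
def horizontalEdge (n r l : ℕ) (hl : l + 1 < n) (hr : r < n) : (grid n).edgeSet :=
  ⟨s((⟨l, by omega⟩, ⟨r, hr⟩), (⟨l + 1, hl⟩, ⟨r, hr⟩)), by
    rw [SimpleGraph.mem_edgeSet, grid_adj_iff]; simp⟩

/-- The vertical edge in column `l` that starts at height `r` (both counted from `0`). -/
def verticalEdge (n r l : ℕ) (hl : l < n) (hr : r + 1 < n) : (grid n).edgeSet :=
  ⟨s((⟨l, hl⟩, ⟨r, by omega⟩), (⟨l, hl⟩, ⟨r + 1, hr⟩)), by
    rw [SimpleGraph.mem_edgeSet, grid_adj_iff]; simp⟩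

theorem plaquetteEvent_abs_le_one {r i : ℕ} {J : Couplings (grid n)}
    (hJ : J ∈ plaquetteEvent n r i) {x : Fin n × Fin n} (hx : IsCorner r i x)
    (hxr : (x.2 : ℕ) = r) (hr : r + 1 < n) {e : (grid n).edgeSet}
    (he : x ∈ (e : Sym2 (Fin n × Fin n))) (hne : e ≠ verticalEdge n r x.1 x.1.2 hr) :
    |J e| ≤ 1 := by
  have h : J e ∈ plaquetteWindow r i e := hJ e (Set.mem_univ e)
  unfold plaquetteWindow at h
  rw [if_pos ⟨x, he, hx⟩, if_neg, if_neg] at h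
  · exact h
  -- An edge from `x` to height `r + 1` can only be the vertical one at `x`.
  · rintro ⟨-, -, z, hz, hzr⟩
    apply hne
    obtain ⟨e, hmem⟩ := e
    have hxz : x ≠ z := fun hxz => by subst hxz; omega
    have heq : e = s(x, z) := ((Sym2.mem_and_mem_iff hxz).1 ⟨he, hz⟩)
    subst heq
    have hadj := grid_adj_iff.1 ((SimpleGraph.mem_edgeSet _).1 hmem)
    apply Subtype.ext
    have h1 : x = (⟨x.1, x.1.2⟩, ⟨r, by omega⟩) := by ext <;> simp [hxr]
    have h2 : z = (⟨x.1, x.1.2⟩, ⟨r + 1, hr⟩) := by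
      ext
      · simp only; omega
      · simp [hzr]
    show s(x, z) = s(((⟨x.1, x.1.2⟩ : Fin n), (⟨r, by omega⟩ : Fin n)), (⟨x.1, x.1.2⟩, ⟨r + 1, hr⟩))
    rw [← h1, ← h2]
  · intro hall
    have := (hall x he).2
    omega

theorem plaquetteEvent_verticalEdge {r i l : ℕ} {J : Couplings (grid n)}
    (hJ : J ∈ plaquetteEvent n r i) (hl : l = 3 * i ∨ l = 3 * i + 1) (hln : l < n)
    (hr : r + 1 < n) :
    4 < |J (verticalEdge n r l hln hr)| ∧ |J (verticalEdge n r l hln hr)| < 5 := by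
  have h : J (verticalEdge n r l hln hr) ∈ plaquetteWindow r i (verticalEdge n r l hln hr) :=
    hJ _ (Set.mem_univ _)
  unfold plaquetteWindow at h
  rw [if_pos, if_neg, if_pos] at h
  · exact h
  · simp [verticalEdge, IsCorner, hl]
  · simp [verticalEdge, IsCorner]
  · simp [verticalEdge, IsCorner, hl]

theorem plaquetteEvent_horizontalEdge {r i : ℕ} {J : Couplings (grid n)}
    (hJ : J ∈ plaquetteEvent n r i) (hl : 3 * i + 1 < n) (hr : r + 1 < n) :
    20 < |J (horizontalEdge n (r + 1) (3 * i) hl hr)| := by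
  have h : J (horizontalEdge n (r + 1) (3 * i) hl hr) ∈
      plaquetteWindow r i (horizontalEdge n (r + 1) (3 * i) hl hr) := hJ _ (Set.mem_univ _)
  unfold plaquetteWindow at h
  rw [if_pos, if_pos] at h
  · exact h
  · simp [horizontalEdge, IsCorner]
  · simp [horizontalEdge, IsCorner]

/-- The vertical side also ends at this corner; its window is capped at 5 so that the top side can
dominate it there. -/
theorem plaquetteEvent_abs_le_five {r i : ℕ} {J : Couplings (grid n)}
    (hJ : J ∈ plaquetteEvent n r i) (hl : 3 * i + 1 < n) (hr : r + 1 < n) {e : (grid n).edgeSet}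
    (he : ((⟨3 * i, by omega⟩, ⟨r + 1, hr⟩) : Fin n × Fin n) ∈ (e : Sym2 (Fin n × Fin n)))
    (hne : e ≠ horizontalEdge n (r + 1) (3 * i) hl hr) :
    |J e| ≤ 5 := by
  have h : J e ∈ plaquetteWindow r i e := hJ e (Set.mem_univ e)
  unfold plaquetteWindow at h
  rw [if_pos ⟨_, he, by simp [IsCorner]⟩, if_neg] at h
  · split_ifs at h
    · exact h.2.le
    · exact le_trans h (by norm_num)
  · intro hall
    apply hne
    obtain ⟨e, hmem⟩ := e
    obtain ⟨z, rfl⟩ := Sym2.mem_iff_exists.1 he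
    have hadj := grid_adj_iff.1 ((SimpleGraph.mem_edgeSet _).1 hmem)
    have hz := hall z (Sym2.mem_mk_right _ _)
    unfold IsCorner at hz
    simp only at hadj
    have h2 : z = (⟨3 * i + 1, hl⟩, ⟨r + 1, hr⟩) := by
      ext <;> simp only <;> omega
    subst h2
    rfl

/-- Since degrees are at most 4, the thresholds 4 = 4·1 and 20 = 4·5 make the vertical sides
dominate at the bottom corners and the top side at the upper left corner. Each edge needs to
dominate at only one end. -/
theorem relativeSpin_signFlip_of_mem_plaquetteEvent [DecidableEq (grid n).edgeSet] {r i : ℕ}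
    (hl : 3 * i + 1 < n) (hr : r + 1 < n) {J : Couplings (grid n)}
    (hJ : J ∈ plaquetteEvent n r i) (hU : UniqueBonds (grid n) J) (u v : Fin n × Fin n) :
    relativeSpin (grid n) u v (signFlip (grid n) (fun e => bond (rightHalf n (3 * i)) e *
        (Pi.mulSingle (horizontalEdge n r (3 * i) hl (by omega)) (-1) :
          (grid n).edgeSet → ℤˣ) e) J) =
      ((rightHalf n (3 * i) u * rightHalf n (3 * i) v : ℤˣ) : ℤ) *
        relativeSpin (grid n) u v J := by
  have hv1 := plaquetteEvent_verticalEdge hJ (Or.inl rfl) (by omega) hr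
  have hv2 := plaquetteEvent_verticalEdge hJ (Or.inr rfl) hl hr
  have hh := plaquetteEvent_horizontalEdge hJ hl hr
  refine relativeSpin_signFlip_of_dominates (grid_preconnected n) hU _
    (a := verticalEdge n r (3 * i) (by omega) hr)
    (b := horizontalEdge n (r + 1) (3 * i) hl hr)
    (c := verticalEdge n r (3 * i + 1) hl hr)
    (x := (⟨3 * i, by omega⟩, ⟨r, by omega⟩)) (y := (⟨3 * i, by omega⟩, ⟨r + 1, hr⟩))
    (z := (⟨3 * i + 1, hl⟩, ⟨r, by omega⟩)) ?_ ?_ ?_ ?_ ?_ ?_ ?_ u v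
  · simp [verticalEdge, horizontalEdge]
  · simp [horizontalEdge]
  · simp [verticalEdge, horizontalEdge]
  · exact grid_dominates zero_le_one (by simp [verticalEdge])
      (fun e he hne => plaquetteEvent_abs_le_one hJ (by simp [IsCorner]) rfl hr he hne)
      (by linarith [hv1.1])
  · exact grid_dominates (M := 5) (by norm_num) (by simp [horizontalEdge])
      (fun e he hne => plaquetteEvent_abs_le_five hJ hl hr he hne) (by linarith)
  · exact grid_dominates zero_le_one (by simp [verticalEdge])
      (fun e he hne => plaquetteEvent_abs_le_one hJ (by simp [IsCorner]) rfl hr he hne)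
      (by linarith [hv2.1])
  · intro σ
    simp only [verticalEdge, horizontalEdge, bond_mk]
    generalize σ (⟨3 * i, _⟩, ⟨r, _⟩) = p
    generalize σ (⟨3 * i, _⟩, ⟨r + 1, _⟩) = q
    generalize σ (⟨3 * i + 1, _⟩, ⟨r, _⟩) = s
    generalize σ (⟨3 * i + 1, _⟩, ⟨r + 1, _⟩) = t
    rcases Int.units_eq_one_or q with rfl | rfl <;> rcases Int.units_eq_one_or t with rfl | rfl <;>
      simp

theorem spectralMass_horizontalLine_le (hpos : 0 < n) (heven : Even n) :
    spectralMass (grid n)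
        (vertex n 1 (n / 2) ⟨le_rfl, hpos⟩ (half_mem hpos heven))
        (vertex n n (n / 2) ⟨hpos, le_rfl⟩ (half_mem hpos heven))
        (horizontalLine n (n / 2) (half_mem hpos heven)) ≤
      (1 - windowProb ^ 16) ^ ((n + 1) / 3) := by
  classical
  have hn : 2 ≤ n := by obtain ⟨m, hm⟩ := heven; omega
  -- Height `n / 2` becomes row `n / 2 - 1` when counted from 0, and there is a row above it.
  have hr : n / 2 - 1 + 1 < n := by omega
  -- The value 1 is a dummy: `i < (n + 1) / 3` is equivalent to `3 * i + 1 < n`.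
  let s : ℕ → (grid n).edgeSet → ℤˣ := fun i e =>
    if hl : 3 * i + 1 < n then bond (rightHalf n (3 * i)) e *
      (Pi.mulSingle (horizontalEdge n (n / 2 - 1) (3 * i) hl (by omega)) (-1) :
        (grid n).edgeSet → ℤˣ) e
    else 1
  have hs : ∀ i (hl : 3 * i + 1 < n), s i = fun e : (grid n).edgeSet => bond (rightHalf n (3 * i)) e *
      (Pi.mulSingle (horizontalEdge n (n / 2 - 1) (3 * i) hl (by omega)) (-1) :
        (grid n).edgeSet → ℤˣ) e := fun i hl => by
    ext e; simp only [s, dif_pos hl]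
  refine (spectralMass_le_measure_iInter_compl (grid n) (grid_preconnected n) _ _ _
    (plaquetteEvent n (n / 2 - 1)) (measurableSet_plaquetteEvent n _)
    (fun i s J => signFlip_mem_plaquetteEvent _ i s J) s ((n + 1) / 3) ?_ ?_).trans ?_
  · rintro i hi ⟨e, hmem⟩ ⟨k, hk, he⟩
    have hl : 3 * i + 1 < n := by omega
    rw [hs i hl]
    simp only at he
    subst he
    -- The line edge with `k = 3 * i + 1` (counted from 1) is the one crossing the cut: its gauge
    -- sign -1 is undone by the extra factor. All other line edges lie on one side of the cut.
    by_cases hki : k = 3 * i + 1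
    · subst hki
      have heq : (⟨_, hmem⟩ : (grid n).edgeSet) =
          horizontalEdge n (n / 2 - 1) (3 * i) hl (by omega) := rfl
      rw [heq]
      beta_reduce
      rw [Pi.mulSingle_eq_same]
      simp [horizontalEdge, rightHalf]
    · beta_reduce
      rw [Pi.mulSingle_eq_of_ne]
      · simp only [bond_mk, rightHalf, vertex, mul_one]
        split_ifs <;> first | rfl | omega
      · simp only [horizontalEdge, vertex, ne_eq, Subtype.mk.injEq, Sym2.eq_iff, Prod.mk.injEq,
          Fin.mk.injEq]
        omega
  · intro i hi J hJ hU
    have hl : 3 * i + 1 < n := by omega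
    rw [hs i hl, relativeSpin_signFlip_of_mem_plaquetteEvent hl hr hJ hU]
    -- The cut separates `v`, in column `n - 1`, from `u`, in column 0.
    have h1 : ¬ (n - 1 ≤ 3 * i) := by omega
    simp [rightHalf, vertex, h1]
  · refine (measure_iInter_compl_le (iIndepSet_plaquetteEvent n _)
      (measurableSet_plaquetteEvent n _)
      (windowProb_pow_le_measure_plaquetteEvent n _) _).trans ?_
    rw [Finset.card_range]

end GridGeometry

end EdwardsAnderson

theorem theorem2p2 :
    ∃ c : ℝ, 0 < c ∧ ∀ (n : ℕ) (hpos : 0 < n) (heven : Even n),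
      EdwardsAnderson.spectralMass (EdwardsAnderson.grid n)
          (EdwardsAnderson.vertex n 1 (n / 2) ⟨le_rfl, hpos⟩
            (EdwardsAnderson.half_mem hpos heven))
          (EdwardsAnderson.vertex n n (n / 2) ⟨hpos, le_rfl⟩
            (EdwardsAnderson.half_mem hpos heven))
          (EdwardsAnderson.horizontalLine n (n / 2) (EdwardsAnderson.half_mem hpos heven))
        ≤ ENNReal.ofReal (Real.exp (-(c * (n : ℝ)))) := by
  set p : ENNReal := EdwardsAnderson.windowProb ^ 16 with hp
  have hp0 : p ≠ 0 := pow_ne_zero _ EdwardsAnderson.windowProb_pos.ne'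
  have hp1 : p ≤ 1 := pow_le_one' EdwardsAnderson.windowProb_le_one 16
  have hptop : p ≠ ⊤ := (hp1.trans_lt ENNReal.one_lt_top).ne
  have hpr : 0 < p.toReal := ENNReal.toReal_pos hp0 hptop
  -- With `m = (n + 1) / 3` plaquettes, `(1 - p) ^ m ≤ exp (-p m)`, and `m ≥ n / 6`.
  refine ⟨p.toReal / 6, by positivity, fun n hpos heven => ?_⟩
  refine (EdwardsAnderson.spectralMass_horizontalLine_le hpos heven).trans ?_
  have h1 : 1 - p ≤ ENNReal.ofReal (Real.exp (-p.toReal)) := by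
    have h2 : 1 - p = ENNReal.ofReal (1 - p.toReal) := by
      rw [ENNReal.ofReal_sub _ hpr.le, ENNReal.ofReal_one, ENNReal.ofReal_toReal hptop]
    rw [h2]
    exact ENNReal.ofReal_le_ofReal (Real.one_sub_le_exp_neg _)
  refine (pow_le_pow_left' h1 _).trans ?_
  rw [← ENNReal.ofReal_pow (Real.exp_pos _).le, ← Real.exp_nat_mul]
  refine ENNReal.ofReal_le_ofReal (Real.exp_le_exp.2 ?_)
  -- False for `n = 1`, which parity excludes.
  have hm : n ≤ 6 * ((n + 1) / 3) := by
    obtain ⟨m, hm⟩ := heven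
    omega
  have hm' : (n : ℝ) ≤ 6 * (((n + 1) / 3 : ℕ) : ℝ) := by exact_mod_cast hm
  nlinarith
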